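/- **Theorem.** Let $\Delta$ be a finite simplicial complex (the empty set counts as a face, of dimension $-1$), not necessarily pure, let $n\ge 0$ be an integer with $\dim\Delta<n$, and let $F_1,\dots,F_m$ be a shelling order of the facets of $\Delta$ in the sense of Björner and Wachs: for $r=2,\dots,m$ the complex $(\overline{F_1}\cup\dots\cup\overline{F_{r-1}})\cap\overline{F_r}$ is pure of dimension $\dim F_r-1$, where $\overline F$ denotes the set of all subsets of $F$. Let $h_{k,i}$ (the $h$-triangle) be the number of indices $r$ such that $\dim F_r+1=k$ and $(\overline{F_1}\cup\dots\cup\overline{F_{r-1}})\cap\overline{F_r}$ has exactly $i$ facets (with $i=0$ for $r=1$). For a finite simplicial complex $\Gamma$ with $\dim\Gamma<n$, the face poset of the $n$-th semisuspension $\operatorname{Semi}(\Gamma,n)$ consists of the faces of $\Gamma$ (including $\widehat 0=\emptyset$) ordered by inclusion, together with an element $*$ above all of them and an element $\widehat 1$ above $*$. Its rank function is $\rho(x)=\dim x+1$ for $x\in\Gamma$, $\rho(*)=n$, $\rho(\widehat 1)=n+1$; put $\rho(x,y)=\rho(y)-\rho(x)$. Its weighted zeta function is $\bar\zeta(x,*)=1+(-1)^{\rho(x,*)}\,\widetilde\chi(\operatorname{link}_\Gamma(x))$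 for $x\in\Gamma$, where $\widetilde\chi$ is the reduced Euler characteristic, and $\bar\zeta(x,y)=1$ for all other $x\le y$. Its $\mathbf{ab}$-index, in noncommuting variables $\mathbf a,\mathbf b$, is $$\Psi(\operatorname{Semi}(\Gamma,n))=\sum_{\widehat 0=x_0<x_1<\dots<x_p=\widehat 1}\Big(\prod_{j=1}^{p}\bar\zeta(x_{j-1},x_j)\Big)\,(\mathbf a-\mathbf b)^{\rho(x_0,x_1)-1}\,\mathbf b\,(\mathbf a-\mathbf b)^{\rho(x_1,x_2)-1}\,\mathbf b\cdots\mathbf b\,(\mathbf a-\mathbf b)^{\rho(x_{p-1},x_p)-1},$$ where chains with $\prod_j\bar\zeta(x_{j-1},x_j)=0$ contribute zero (this covers the pairs $x<*$ with $\rho(x)=n$, for which $\bar\zeta(x,*)=0$). For $0\le i\le k\le n$ let $\Delta_{k,i}$ be the simplicial complex generated by $i+1$ of the facets of the $k$-dimensional simplex, and define the shelling components by $\check\Phi(n,k,0)=\Psi(\operatorname{Semi}(\Delta_{k,0},n))$ and $\check\Phi(n,k,i)=\Psi(\operatorname{Semi}(\Delta_{k,i},n))-\Psi(\operatorname{Semi}(\Delta_{k,i-1},n))$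 for $1\le i\le k$. Then $\Psi(\operatorname{Semi}(\Delta,n))$ is a polynomial with integer coefficients in $\mathbf c=\mathbf a+\mathbf b$ and $\mathbf d=\mathbf a\mathbf b+\mathbf b\mathbf a$ (the $\mathbf{cd}$-index of the semisuspension), and $$\Psi(\operatorname{Semi}(\Delta,n))=\sum_{k=0}^{n}\sum_{i=0}^{k}h_{k,i}\,\check\Phi(n,k,i).$$ -/

import Mathlib

namespace Semisusp

noncomputable section

/-! ### Polynomials in the noncommuting variables `a`, `b` -/

/-- The two noncommuting variables. -/
inductive ABVar
  | a
  | b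

/-- The ring `ℤ⟨a, b⟩` of noncommutative polynomials in `a` and `b`. -/
abbrev ABPoly : Type := FreeAlgebra ℤ ABVar

/-- The variable `a`. -/
def va : ABPoly := FreeAlgebra.ι ℤ ABVar.a

/-- The variable `b`. -/
def vb : ABPoly := FreeAlgebra.ι ℤ ABVar.b

/-- `c = a + b`. -/
def vc : ABPoly := va + vb

/-- `d = ab + ba`. -/
def vd : ABPoly := va * vb + vb * va

/-- The subring `ℤ⟨c, d⟩` of `ℤ⟨a, b⟩`. An `ab`-index lying in it is called a `cd`-index. -/
def cdPoly : Subalgebra ℤ ABPoly := Algebra.adjoin ℤ {vc, vd}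

/-! ### Quasi-graded posets and their `ab`-index -/

/-- A quasi-graded poset structure on a finite poset `P`: a rank function and a weighted zeta
function in the incidence algebra (integer-valued here) with `ζ̄(x, x) = 1`.
The rank is order preserving, and strictly so on every pair `x < y` with `ζ̄(x, y) ≠ 0`.
Strictness is not required where `ζ̄(x, y) = 0`, because in the `n`-th semisuspension of an
`(n - 1)`-dimensional complex the facets of rank `n` lie below the element `*`, also of rank `n`,
with `ζ̄ = 0`; chains through such pairs contribute zero to the `ab`-index. -/
structure QuasiGradedPoset (P : Type*) [PartialOrder P] [Finite P] where
  rank : P → ℕ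
  zeta : IncidenceAlgebra ℤ P
  rank_mono : ∀ x y, x ≤ y → rank x ≤ rank y
  rank_lt : ∀ x y, x < y → zeta x y ≠ 0 → rank x < rank y
  zeta_self : ∀ x, zeta x x = 1

/-- The chains `0̂ = x₀ < x₁ < ⋯ < x_k = 1̂`, as lists `[x₀, x₁, …, x_k]`. -/
def maxMinChains (P : Type*) [PartialOrder P] [BoundedOrder P] : Set (List P) :=
  {l | l.IsChain (· < ·) ∧ l.head? = some ⊥ ∧ l.getLast? = some ⊤}

theorem finite_maxMinChains (P : Type*) [PartialOrder P] [BoundedOrder P] [Finite P] :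
    (maxMinChains P).Finite := by
  classical
  have := Fintype.ofFinite P
  refine (List.finite_length_le P (Fintype.card P)).subset ?_
  rintro l ⟨hl, -, -⟩
  exact (List.Pairwise.nodup (r := (· < ·)) (List.isChain_iff_pairwise.mp hl)).length_le_card

namespace QuasiGradedPoset

variable {P : Type*} [PartialOrder P] [Finite P] (Q : QuasiGradedPoset P)

/-- `ζ̄(c) = ζ̄(x₀, x₁) ⋯ ζ̄(x_{k-1}, x_k)`. -/
def chainZeta : List P → ℤ
  | x :: y :: l => Q.zeta x y * chainZeta (y :: l)
  | _ => 1

/-- `wt(c) = (a-b)^{ρ(x₀,x₁)-1} b (a-b)^{ρ(x₁,x₂)-1} b ⋯ b (a-b)^{ρ(x_{k-1},x_k)-1}`. -/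
def chainWeight : List P → ABPoly
  | [x, y] => (va - vb) ^ (Q.rank y - Q.rank x - 1)
  | x :: y :: z :: l =>
      (va - vb) ^ (Q.rank y - Q.rank x - 1) * vb * chainWeight (y :: z :: l)
  | _ => 1

/-- The `ab`-index `Ψ(P, ρ, ζ̄) = ∑_c ζ̄(c) wt(c)`, over all chains from `0̂` to `1̂`. -/
def abIndex [BoundedOrder P] : ABPoly :=
  ∑ l ∈ (finite_maxMinChains P).toFinset, Q.chainZeta l • Q.chainWeight l

end QuasiGradedPoset

/-! ### Simplicial complexes: Mathlib's complexes, together with the empty face -/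

section Complex

variable {V : Type*}

/-- All faces of `Δ`, including the empty face (which Mathlib's `Δ.faces` leaves out). -/
def allFaces (Δ : PreAbstractSimplicialComplex V) : Set (Finset V) := insert ∅ Δ.faces

/-- `dim Δ < n`, where `dim F = |F| - 1`. -/
def DimLT (Δ : PreAbstractSimplicialComplex V) (n : ℕ) : Prop :=
  ∀ F ∈ allFaces Δ, F.card ≤ n

/-- The facets: the inclusion-maximal faces. -/
def IsFacet (Δ : PreAbstractSimplicialComplex V) (F : Finset V) : Prop :=
  Maximal (· ∈ allFaces Δ) F

/-- The link of `F` in `Δ`: the faces `G` disjoint from `F` such that `F ∪ G` is a face. -/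
def link [DecidableEq V] (Δ : PreAbstractSimplicialComplex V) (F : Finset V) :
    PreAbstractSimplicialComplex V where
  faces := {G | G.Nonempty ∧ Disjoint F G ∧ F ∪ G ∈ Δ.faces}
  isRelLowerSet_faces := by
    rintro G ⟨hG, hd, hF⟩
    refine ⟨hG, fun H hHG hH => ⟨hH, hd.mono_right hHG, ?_⟩⟩
    exact (Δ.isRelLowerSet_faces hF).2 (Finset.union_subset_union_right hHG)
      (hH.mono Finset.subset_union_right)

/-- The reduced Euler characteristic `χ̃(Δ) = ∑_F (-1)^{dim F}` of a finite complex,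
over all faces including the empty one (`dim ∅ = -1`); note that `(-1)^{|F|+1} = (-1)^{dim F}`. -/
def reducedEulerChar (Δ : PreAbstractSimplicialComplex V) : ℤ :=
  ∑ᶠ F ∈ allFaces Δ, (-1 : ℤ) ^ (F.card + 1)

/-! ### The semisuspension -/

/-- The poset of all faces of `Δ` (including `∅`), ordered by inclusion. -/
abbrev FacePoset (Δ : PreAbstractSimplicialComplex V) : Type _ := {F : Finset V // F ∈ allFaces Δ}

instance (Δ : PreAbstractSimplicialComplex V) : OrderBot (FacePoset Δ) where
  bot := ⟨∅, Set.mem_insert _ _⟩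
  bot_le F := Finset.empty_subset F.1

instance (Δ : PreAbstractSimplicialComplex V) [Finite Δ.faces] : Finite (FacePoset Δ) :=
  ((Set.toFinite Δ.faces).insert ∅).to_subtype

/-- The elements of the face poset of the semisuspension: the faces of `Δ`, an element `*` above
all of them, and a maximal element `1̂` above `*`. -/
abbrev SemiPoset (Δ : PreAbstractSimplicialComplex V) : Type _ := WithTop (WithTop (FacePoset Δ))

instance (Δ : PreAbstractSimplicialComplex V) [Finite Δ.faces] : Finite (SemiPoset Δ) :=
  inferInstanceAs (Finite (Option (Option (FacePoset Δ))))

/-- The rank function: `ρ(F) = |F| = dim F + 1`, `ρ(*) = n`, `ρ(1̂) = n + 1`. -/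
def semiRank (Δ : PreAbstractSimplicialComplex V) (n : ℕ) : SemiPoset Δ → ℕ
  | WithTop.some (WithTop.some F) => F.1.card
  | WithTop.some ⊤ => n
  | ⊤ => n + 1

variable [DecidableEq V]

/-- The weighted zeta function on pairs `x ≤ y`: `ζ̄(F, *) = 1 + (-1)^{ρ(F,*)} χ̃(link F)` for a
face `F`, and `ζ̄(x, y) = 1` otherwise. -/
def semiZetaFun (Δ : PreAbstractSimplicialComplex V) (n : ℕ) : SemiPoset Δ → SemiPoset Δ → ℤ
  | WithTop.some (WithTop.some F), WithTop.some ⊤ =>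
      1 + (-1) ^ (n - F.1.card) * reducedEulerChar (link Δ F.1)
  | _, _ => 1

open Classical in
/-- The weighted zeta function as an element of the incidence algebra. -/
def semiZeta (Δ : PreAbstractSimplicialComplex V) (n : ℕ) : IncidenceAlgebra ℤ (SemiPoset Δ) where
  toFun x y := if x ≤ y then semiZetaFun Δ n x y else 0
  eq_zero_of_not_le' _ _ h := if_neg h

theorem semiZeta_apply (Δ : PreAbstractSimplicialComplex V) (n : ℕ) {x y : SemiPoset Δ}
    (h : x ≤ y) : semiZeta Δ n x y = semiZetaFun Δ n x y :=
  if_pos h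

/-- A face of the largest possible rank `n` has link `{∅}`, whose reduced Euler characteristic
is `-1`. -/
theorem reducedEulerChar_link_of_card_eq (Δ : PreAbstractSimplicialComplex V) (n : ℕ)
    (hn : DimLT Δ n) (F : Finset V) (hF : F.card = n) : reducedEulerChar (link Δ F) = -1 := by
  have h : allFaces (link Δ F) = {∅} := by
    ext G
    refine ⟨?_, fun h => Or.inl h⟩
    rintro (h | ⟨hG, hd, hFG⟩)
    · exact h
    · have h1 := hn _ (Or.inr hFG)
      rw [Finset.card_union_of_disjoint hd] at h1
      have h2 := hG.card_pos
      omega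
  simp [reducedEulerChar, h]

/-- The face poset of the `n`-th semisuspension `Semi(Δ, n)` of a finite simplicial complex `Δ`
of dimension less than `n`, as a quasi-graded poset. -/
def semi (Δ : PreAbstractSimplicialComplex V) [Finite Δ.faces] (n : ℕ) (hn : DimLT Δ n) :
    QuasiGradedPoset (SemiPoset Δ) where
  rank := semiRank Δ n
  zeta := semiZeta Δ n
  rank_mono := by
    rintro (_ | _ | F) (_ | _ | G) h
    · exact le_rfl
    · exact absurd h (by simp [WithTop.none_eq_top, WithTop.some_eq_coe])
    · exact absurd h (by simp [WithTop.none_eq_top, WithTop.some_eq_coe])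
    · exact Nat.le_succ n
    · exact le_rfl
    · exact absurd (WithTop.coe_le_coe.mp h) (by simp [WithTop.none_eq_top, WithTop.some_eq_coe])
    · exact (hn F.1 F.2).trans (Nat.le_succ n)
    · exact hn F.1 F.2
    · have h' : F ≤ G := by simpa [WithTop.some_eq_coe] using h
      exact Finset.card_le_card h'
  rank_lt := by
    rintro (_ | _ | F) (_ | _ | G) h hz
    · exact absurd h (lt_irrefl _)
    · exact absurd h (by simp [WithTop.none_eq_top, WithTop.some_eq_coe])
    · exact absurd h (by simp [WithTop.none_eq_top, WithTop.some_eq_coe])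
    · exact Nat.lt_succ_self n
    · exact absurd h (lt_irrefl _)
    · exact absurd (WithTop.coe_lt_coe.mp h) (by simp [WithTop.none_eq_top, WithTop.some_eq_coe])
    · exact (hn F.1 F.2).trans_lt (Nat.lt_succ_self n)
    · refine lt_of_le_of_ne (hn F.1 F.2) fun hc : F.1.card = n => hz ?_
      rw [semiZeta_apply Δ n h.le]
      change 1 + (-1) ^ (n - F.1.card) * reducedEulerChar (link Δ F.1) = 0
      rw [reducedEulerChar_link_of_card_eq Δ n hn F.1 hc, hc]
      simp
    · have h' : F < G := by simpa [WithTop.some_eq_coe] using h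
      exact Finset.card_lt_card h'
  zeta_self := by
    rintro (_ | _ | F) <;> exact semiZeta_apply Δ n le_rfl

end Complex

/-! ### Shelling components -/

/-- `Δ_{k,i}`: the complex generated by `i + 1` facets of the `k`-dimensional simplex; the simplex
has vertex set `{0, …, k}`, and the chosen facets are those opposite to the vertices `0, …, i`. -/
def simplexFacets (k i : ℕ) : PreAbstractSimplicialComplex (Fin (k + 1)) where
  faces := {s | s.Nonempty ∧ ∃ j : Fin (k + 1), (j : ℕ) ≤ i ∧ j ∉ s}
  isRelLowerSet_faces := by
    rintro s ⟨hs, j, hj, hjs⟩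
    exact ⟨hs, fun t hts ht => ⟨ht, j, hj, fun h => hjs (hts h)⟩⟩

theorem dimLT_simplexFacets {n k : ℕ} (hk : k ≤ n) (i : ℕ) : DimLT (simplexFacets k i) n := by
  rintro s (rfl | ⟨-, j, -, hj⟩)
  · simp
  · have h : s.card < (Finset.univ : Finset (Fin (k + 1))).card :=
      Finset.card_lt_card
        ⟨Finset.subset_univ s, fun h => hj (h (Finset.mem_univ j))⟩
    simp at h
    omega

/-- `Ψ(P_{n,k,i})`, where `P_{n,k,i}` is the face poset of `Semi(Δ_{k,i}, n)`. -/
def psiP (n k : ℕ) (hk : k ≤ n) (i : ℕ) : ABPoly :=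
  (semi (simplexFacets k i) n (dimLT_simplexFacets hk i)).abIndex

/-- The shelling component `Φ̌(n,k,i)`: `Φ̌(n,k,0) = Ψ(P_{n,k,0})`, and
`Φ̌(n,k,i) = Ψ(P_{n,k,i}) - Ψ(P_{n,k,i-1})` for `i ≥ 1`. -/
def shellingComponent (n k : ℕ) (hk : k ≤ n) : ℕ → ABPoly
  | 0 => psiP n k hk 0
  | i + 1 => psiP n k hk (i + 1) - psiP n k hk i

/-! ### Nonpure shellings and the `h`-triangle -/

section Shelling

variable {V : Type*}

/-- The faces of `(F̄₁ ∪ ⋯ ∪ F̄_{r-1}) ∩ F̄_r`, where `F̄` is the set of all subsets of `F`. -/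
def priorIntersection {m : ℕ} (F : Fin m → Finset V) (r : Fin m) : Set (Finset V) :=
  {G | (∃ j, j < r ∧ G ⊆ F j) ∧ G ⊆ F r}

/-- `F` lists the facets of `Δ`, each exactly once, in a (nonpure) shelling order: for every facet
`F r` but the first, the intersection of `F̄ r` with the union of the earlier closed facets is pure
of dimension `dim (F r) - 1`. -/
structure IsShellingOrder (Δ : PreAbstractSimplicialComplex V) {m : ℕ}
    (F : Fin m → Finset V) : Prop where
  injective : Function.Injective F
  range_eq : Set.range F = {G | IsFacet Δ G}
  pure : ∀ r : Fin m, 0 < (r : ℕ) → ∀ G, Maximal (· ∈ priorIntersection F r) G →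
    G.card + 1 = (F r).card

/-- The entry `h_{k,i}` of the `h`-triangle: the number of facets `F r` of shelling type `(k,i)`,
that is, with `dim (F r) + 1 = k` and such that the intersection of `F̄ r` with the union of the
earlier closed facets has exactly `i` facets. -/
def hTriangle {m : ℕ} (F : Fin m → Finset V) (k i : ℕ) : ℕ :=
  (Finset.univ.filter fun r : Fin m =>
    (F r).card = k ∧ {G | Maximal (· ∈ priorIntersection F r) G}.ncard = i).card

end Shelling

end

end Semisusp

namespace Semisusp

/-! Everything reduces to the f-vector. Every interval `[∅, G]` is Boolean with `ζ̄ = 1`, so the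
chains up to a face `G` contribute an expression in `|G|` alone. Writing `χ̃(link G)` as a signed
sum over the faces `H ⊇ G` and exchanging the sums turns `Ψ(Semi(Δ, n))` into a sum over all faces
of `faceTerm n |G|` (`abIndex_semi_eq_sum_faceTerm`). Both conclusions follow from this additivity.

For the `cd`-index, each `faceTerm n k` with `k ≤ n` lies in `ℤ⟨c, d⟩`: for `0 < k < n` it is the
Boolean index of rank `k` times an explicit `cd`-polynomial (`faceTerm_of_lt`,
`vb_mul_pow_mul_va_mem`). Boolean indices are `cd`-polynomials by induction on the rank, since the
semisuspension of a simplex boundary expresses the next one through face terms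
(`sum_choose_smul_faceTerm`).

For the shelling formula, the faces new at step `r` form the interval `[R, F r]`, where `R` is the
restriction, with `|R|` equal to the number of facets of the prior intersection. Summed over such an
interval, the face terms depend only on `(|F r|, |R|)`. Passing from `Δ_{k,i-1}` to `Δ_{k,i}` adds
one interval of the same type `(k, i)`, so the shelling component is exactly this sum
(`shellingComponent_eq_typeTerm`). -/

/-! ### Recursion for the `ab`-index along chains -/

/-- The chains from `⊥` to `x`, as lists. -/
def chainsTo {P : Type*} [PartialOrder P] [OrderBot P] (x : P) : Set (List P) :=
  {l | l.IsChain (· < ·) ∧ l.head? = some ⊥ ∧ l.getLast? = some x}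

theorem finite_chainsTo {P : Type*} [PartialOrder P] [OrderBot P] [Finite P] (x : P) :
    (chainsTo x).Finite := by
  classical
  have := Fintype.ofFinite P
  refine (List.finite_length_le P (Fintype.card P)).subset ?_
  rintro l ⟨hl, -, -⟩
  exact (List.Pairwise.nodup (r := (· < ·)) (List.isChain_iff_pairwise.mp hl)).length_le_card

theorem chainsTo_bot {P : Type*} [PartialOrder P] [OrderBot P] :
    chainsTo (⊥ : P) = {[⊥]} := by
  ext l
  simp only [chainsTo, Set.mem_ofPred_eq, Set.mem_singleton_iff]
  constructor
  · rintro ⟨hc, hh, hl⟩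
    rcases List.eq_nil_or_concat l with rfl | ⟨l', z, rfl⟩
    · simp at hh
    · rw [List.concat_eq_append] at *
      have hz : z = ⊥ := by simpa using hl
      subst hz
      rcases l' with _ | ⟨w, l'⟩
      · rfl
      · have := (List.pairwise_append.mp (List.isChain_iff_pairwise.mp hc)).2.2 w (by simp) ⊥
          (by simp)
        exact absurd this not_lt_bot
  · rintro rfl
    simp

theorem concat_mem_chainsTo {P : Type*} [PartialOrder P] [OrderBot P] {x y : P} (h : x < y)
    {l : List P} (hl : l ∈ chainsTo x) : l ++ [y] ∈ chainsTo y := by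
  obtain ⟨hc, hh, hx⟩ := hl
  refine ⟨?_, ?_, by simp⟩
  · refine List.IsChain.append hc (by simp) ?_
    intro a ha b hb
    rw [hx] at ha
    simp at ha hb
    subst ha hb
    exact h
  · simp [List.head?_append, hh]

theorem exists_of_mem_chainsTo {P : Type*} [PartialOrder P] [OrderBot P] {y : P} (hy : y ≠ ⊥)
    {l : List P} (hl : l ∈ chainsTo y) : ∃ x, x < y ∧ ∃ l' ∈ chainsTo x, l = l' ++ [y] := by
  obtain ⟨hc, hh, hx⟩ := hl
  rcases List.eq_nil_or_concat l with rfl | ⟨l', z, rfl⟩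
  · simp at hh
  · rw [List.concat_eq_append] at *
    have hz : z = y := by simpa using hx
    subst hz
    rcases List.eq_nil_or_concat l' with rfl | ⟨l'', x, rfl⟩
    · simp at hh
      exact absurd hh hy
    · rw [List.concat_eq_append] at *
      have hp := List.pairwise_append.mp (List.isChain_iff_pairwise.mp hc)
      refine ⟨x, hp.2.2 x (by simp) z (by simp), l'' ++ [x], ⟨?_, ?_, by simp⟩, rfl⟩
      · exact List.isChain_iff_pairwise.mpr hp.1
      · rw [List.head?_append] at hh
        cases h : (l'' ++ [x]).head? with
        | none => simp at h
        | some w => simpa [h] using hh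

/-- Chains to `y ≠ ⊥` are sorted by their last element but one. -/
theorem sum_chainsTo {P M : Type*} [PartialOrder P] [OrderBot P] [Fintype P] [AddCommMonoid M]
    {y : P} [DecidablePred fun x : P => x < y] (hy : y ≠ ⊥) (g : List P → M) :
    ∑ l ∈ (finite_chainsTo y).toFinset, g l =
      ∑ x : P with x < y, ∑ l ∈ (finite_chainsTo x).toFinset, g (l ++ [y]) := by
  rw [Finset.sum_sigma']
  symm
  refine Finset.sum_bij (fun p _ => p.2 ++ [y]) ?_ ?_ ?_ ?_
  · rintro ⟨x, l⟩ h
    simp only [Finset.mem_sigma, Finset.mem_filter, Finset.mem_univ, true_and,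
      Set.Finite.mem_toFinset] at h ⊢
    exact concat_mem_chainsTo h.1 h.2
  · rintro ⟨x, l⟩ h ⟨x', l'⟩ h' heq
    simp only [Finset.mem_sigma, Finset.mem_filter, Finset.mem_univ, true_and,
      Set.Finite.mem_toFinset] at h h'
    have hll : l = l' := by simpa using heq
    subst hll
    have : x = x' := Option.some_injective _ (h.2.2.2.symm.trans h'.2.2.2)
    subst this
    rfl
  · intro l hl
    obtain ⟨x, hx, l', hl', rfl⟩ := exists_of_mem_chainsTo hy ((Set.Finite.mem_toFinset _).mp hl)
    exact ⟨⟨x, l'⟩, by simpa using ⟨hx, hl'⟩, rfl⟩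
  · intros
    rfl

namespace QuasiGradedPoset

variable {P : Type*} [PartialOrder P] [Finite P] (Q : QuasiGradedPoset P)

/-- The weight `(a-b)^{ρ(x₀,x₁)-1} b ⋯ (a-b)^{ρ(x_{k-1},x_k)-1} b`, with a trailing `b`. -/
noncomputable def openWeight : List P → ABPoly
  | x :: y :: l => (va - vb) ^ (Q.rank y - Q.rank x - 1) * vb * openWeight (y :: l)
  | _ => 1

theorem openWeight_concat (y x : P) : ∀ l : List P, l.getLast? = some x →
    Q.openWeight (l ++ [y]) =
      Q.openWeight l * ((va - vb) ^ (Q.rank y - Q.rank x - 1) * vb)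
  | [], h => by simp at h
  | [z], h => by
      have : z = x := by simpa using h
      subst this
      simp [openWeight]
  | z :: w :: l, h => by
      have := openWeight_concat y x (w :: l) (by simpa using h)
      simp only [List.cons_append, openWeight] at this ⊢
      rw [this]
      simp only [mul_assoc]

theorem chainWeight_concat (y x : P) : ∀ l : List P, l.getLast? = some x →
    Q.chainWeight (l ++ [y]) = Q.openWeight l * (va - vb) ^ (Q.rank y - Q.rank x - 1)
  | [], h => by simp at h
  | [z], h => by
      have : z = x := by simpa using h
      subst this
      simp [openWeight, chainWeight]
  | z :: w :: l, h => by
      have := chainWeight_concat y x (w :: l) (by simpa using h)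
      rcases l with _ | ⟨v, l⟩ <;>
        simp only [List.cons_append, List.nil_append, chainWeight, openWeight] at this ⊢ <;>
        rw [this] <;> simp only [mul_assoc]

theorem chainZeta_concat (y x : P) : ∀ l : List P, l.getLast? = some x →
    Q.chainZeta (l ++ [y]) = Q.chainZeta l * Q.zeta x y
  | [], h => by simp at h
  | [z], h => by
      have : z = x := by simpa using h
      subst this
      simp [chainZeta]
  | z :: w :: l, h => by
      have := chainZeta_concat y x (w :: l) (by simpa using h)
      simp only [List.cons_append, chainZeta] at this ⊢
      rw [this, mul_assoc]

/-- The sum of `ζ̄(c)` times the open weight of `c`, over all chains `c` from `⊥` to `x`. -/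
noncomputable def openIndex [OrderBot P] (x : P) : ABPoly :=
  ∑ l ∈ (finite_chainsTo x).toFinset, Q.chainZeta l • Q.openWeight l

theorem openIndex_bot [OrderBot P] : Q.openIndex ⊥ = 1 := by
  have : (finite_chainsTo (⊥ : P)).toFinset = {[⊥]} := by
    ext
    simp [chainsTo_bot]
  simp [openIndex, this, chainZeta, openWeight]

theorem openIndex_of_ne_bot [OrderBot P] [Fintype P] {y : P}
    [DecidablePred fun x : P => x < y] (hy : y ≠ ⊥) :
    Q.openIndex y = ∑ x : P with x < y,
      Q.zeta x y • (Q.openIndex x * ((va - vb) ^ (Q.rank y - Q.rank x - 1) * vb)) := by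
  rw [openIndex, sum_chainsTo hy]
  refine Finset.sum_congr rfl fun x _ => ?_
  rw [openIndex, Finset.sum_mul, Finset.smul_sum]
  refine Finset.sum_congr rfl fun l hl => ?_
  have h := ((Set.Finite.mem_toFinset _).mp hl).2.2
  rw [Q.openWeight_concat y x l h, Q.chainZeta_concat y x l h, smul_mul_assoc, smul_smul,
    mul_comm]

/-- The final step into `⊤` carries no trailing `b`; this is the only difference from the recursion
for `openIndex`. -/
theorem abIndex_eq_sum_openIndex [BoundedOrder P] [Fintype P]
    [DecidablePred fun x : P => x < ⊤] (h : (⊤ : P) ≠ ⊥) :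
    Q.abIndex = ∑ x : P with x < ⊤,
      Q.zeta x ⊤ • (Q.openIndex x * (va - vb) ^ (Q.rank ⊤ - Q.rank x - 1)) := by
  have : Q.abIndex = ∑ l ∈ (finite_chainsTo (⊤ : P)).toFinset,
      Q.chainZeta l • Q.chainWeight l := rfl
  rw [this, sum_chainsTo h]
  refine Finset.sum_congr rfl fun x _ => ?_
  rw [openIndex, Finset.sum_mul, Finset.smul_sum]
  refine Finset.sum_congr rfl fun l hl => ?_
  have h := ((Set.Finite.mem_toFinset _).mp hl).2.2
  rw [Q.chainWeight_concat ⊤ x l h, Q.chainZeta_concat ⊤ x l h, smul_mul_assoc, smul_smul,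
    mul_comm]

end QuasiGradedPoset

/-! ### Boolean lattices and the contribution of one face -/

/-- The chains from `∅` to a `k`-element set in the Boolean lattice, each weighted by the product
of `(a-b)^{ρ(x,y)-1} b` over its steps. -/
noncomputable def booleanOpen (k : ℕ) : ABPoly :=
  if k = 0 then 1 else
    ∑ j : Fin k, k.choose j • (booleanOpen j * ((va - vb) ^ (k - j - 1) * vb))

theorem booleanOpen_zero : booleanOpen 0 = 1 := by
  rw [booleanOpen, if_pos rfl]

/-- The `ab`-index of the Boolean lattice of rank `k`, for `k > 0`. -/
noncomputable def booleanIndex (k : ℕ) : ABPoly :=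
  ∑ j ∈ Finset.range k, k.choose j • (booleanOpen j * (va - vb) ^ (k - j - 1))

theorem booleanOpen_of_pos {k : ℕ} (hk : 0 < k) : booleanOpen k = booleanIndex k * vb := by
  rw [booleanOpen, if_neg hk.ne', booleanIndex, Finset.sum_mul,
    ← Fin.sum_univ_eq_sum_range (fun j => k.choose j •
      (booleanOpen j * (va - vb) ^ (k - j - 1)) * vb)]
  simp only [smul_mul_assoc, mul_assoc]

/-- The contribution of a face with `k` elements to the `ab`-index of the `n`-th
semisuspension. -/
noncomputable def faceTerm (n k : ℕ) : ABPoly :=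
  booleanOpen k * (va - vb) ^ (n - k) + booleanOpen k * ((va - vb) ^ (n - k - 1) * vb) +
    ∑ j ∈ Finset.range (k + 1), k.choose j • (-1 : ℤ) ^ ((n - j) + (k - j) + 1) •
      (booleanOpen j * ((va - vb) ^ (n - j - 1) * vb))

/-! ### Membership in `ℤ⟨c, d⟩` -/

theorem vc_mem : vc ∈ cdPoly := Algebra.subset_adjoin (by simp)

theorem vd_mem : vd ∈ cdPoly := Algebra.subset_adjoin (by simp)

theorem sq_sub_eq : (va - vb) ^ 2 = vc ^ 2 - 2 * vd := by
  simp only [vc, vd]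
  noncomm_ring

theorem sq_sub_mem : (va - vb) ^ 2 ∈ cdPoly := by
  rw [sq_sub_eq]
  have h2 : (2 : ABPoly) ∈ cdPoly := by exact_mod_cast cdPoly.natCast_mem 2
  exact sub_mem (pow_mem vc_mem _) (mul_mem h2 vd_mem)

/-- For even `m` this is a power of `(a-b)²` times `c`; for odd `m` it is the even power
`(a-b)^(m+1)`. It is the contribution of the empty face. -/
theorem pow_sub_mul_mem (m : ℕ) : (va - vb) ^ m * (va + (-1) ^ m * vb) ∈ cdPoly := by
  rcases Nat.even_or_odd' m with ⟨k, rfl | rfl⟩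
  · rw [pow_mul, pow_mul]
    simpa [vc] using mul_mem (pow_mem sq_sub_mem k) vc_mem
  · have : (va - vb) ^ (2 * k + 1) * (va + (-1) ^ (2 * k + 1) * vb) =
        ((va - vb) ^ 2) ^ (k + 1) := by
      rw [Odd.neg_one_pow ⟨k, rfl⟩, neg_one_mul, ← sub_eq_add_neg, ← pow_succ, ← pow_mul]
      rfl
    rw [this]
    exact pow_mem sq_sub_mem _

/-- Since `a - b` commutes with `(a-b)²`, the variables `a` and `b` have the same commutator with
it, namely `cd - dc` up to sign. Pulling `(a-b)²` to the left lowers `m` by two, with a correction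
that `pow_sub_mul_mem` covers. -/
theorem vb_mul_pow_mul_va_mem : ∀ m : ℕ,
    vb * (va - vb) ^ m * va + (-1) ^ m * (va * (va - vb) ^ m * vb) ∈ cdPoly
  | 0 => by
      have : vb * (va - vb) ^ 0 * va + (-1) ^ 0 * (va * (va - vb) ^ 0 * vb) = vd := by
        simp [vd, add_comm]
      rw [this]
      exact vd_mem
  | 1 => by
      have : vb * (va - vb) ^ 1 * va + (-1) ^ 1 * (va * (va - vb) ^ 1 * vb) =
          vd * vc - vc * vd := by
        simp only [vc, vd]
        noncomm_ring
      rw [this]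
      exact sub_mem (mul_mem vd_mem vc_mem) (mul_mem vc_mem vd_mem)
  | m + 2 => by
      have ha : va * (va - vb) ^ 2 = (va - vb) ^ 2 * va - (vc * vd - vd * vc) := by
        simp only [vc, vd]
        noncomm_ring
      have hb : vb * (va - vb) ^ 2 = (va - vb) ^ 2 * vb - (vc * vd - vd * vc) := by
        simp only [vc, vd]
        noncomm_ring
      have : vb * (va - vb) ^ (m + 2) * va + (-1) ^ (m + 2) * (va * (va - vb) ^ (m + 2) * vb) =
          (va - vb) ^ 2 * (vb * (va - vb) ^ m * va + (-1) ^ m * (va * (va - vb) ^ m * vb)) -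
            (vc * vd - vd * vc) * ((va - vb) ^ m * (va + (-1) ^ m * vb)) := by
        rw [add_comm m 2, pow_add (va - vb), ← mul_assoc vb, ← mul_assoc va, ha, hb, pow_add]
        rcases neg_one_pow_eq_or ABPoly m with h | h <;> rw [h] <;> noncomm_ring
      rw [this]
      exact sub_mem (mul_mem sq_sub_mem (vb_mul_pow_mul_va_mem m))
        (mul_mem (sub_mem (mul_mem vc_mem vd_mem) (mul_mem vd_mem vc_mem)) (pow_sub_mul_mem m))

theorem faceTerm_zero_zero : faceTerm 0 0 = 1 := by
  simp [faceTerm, booleanOpen_zero]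

theorem faceTerm_zero (m : ℕ) :
    faceTerm (m + 1) 0 = (va - vb) ^ m * (va + (-1) ^ m * vb) := by
  simp only [faceTerm, booleanOpen_zero]
  rcases Nat.even_or_odd m with h | h
  · simp [h.neg_one_pow, booleanOpen_zero, pow_succ]
    noncomm_ring
  · simp only [h.neg_one_pow, pow_succ, zero_add, Finset.sum_range_one, booleanOpen_zero,
      Nat.choose_self, Nat.sub_zero, Nat.add_sub_cancel, one_mul, one_smul, Nat.add_zero]
    generalize (va - vb) ^ m = u
    noncomm_ring

theorem faceTerm_self {n : ℕ} (hn : 0 < n) : faceTerm n n = 0 := by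
  rw [faceTerm, Finset.sum_range_succ]
  -- All signs are `-1`, so the terms `j < n` cancel the first summand of `faceTerm`. The `j = n`
  -- term cancels the second, both having the truncated exponent `n - n - 1 = 0`.
  have : ∑ j ∈ Finset.range n, n.choose j • (-1 : ℤ) ^ ((n - j) + (n - j) + 1) •
      (booleanOpen j * ((va - vb) ^ (n - j - 1) * vb)) = - booleanOpen n := by
    rw [booleanOpen_of_pos hn, booleanIndex, Finset.sum_mul, ← Finset.sum_neg_distrib]
    refine Finset.sum_congr rfl fun j _ => ?_
    rw [Odd.neg_one_pow ⟨n - j, by ring⟩]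
    simp [mul_assoc]
  rw [this]
  simp
  abel

/-- For every `j ≤ k` the sign is `(-1)^m`, as the exponent changes by an even amount with `j`.
Hence the terms `j < k` reassemble `booleanIndex k`, which also divides `booleanOpen k` on the left.
-/
theorem faceTerm_of_lt {k : ℕ} (hk : 0 < k) (m : ℕ) :
    faceTerm (k + m + 1) k = booleanIndex k *
      (vb * (va - vb) ^ m * va + (-1) ^ m * (va * (va - vb) ^ m * vb)) := by
  rw [faceTerm, Finset.sum_range_succ]
  have h1 : ∑ j ∈ Finset.range k, k.choose j • (-1 : ℤ) ^ ((k + m + 1 - j) + (k - j) + 1) •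
      (booleanOpen j * ((va - vb) ^ (k + m + 1 - j - 1) * vb)) =
      booleanIndex k * ((-1) ^ m * ((va - vb) ^ (m + 1) * vb)) := by
    rw [booleanIndex, Finset.sum_mul]
    refine Finset.sum_congr rfl fun j hj => ?_
    have hj := Finset.mem_range.mp hj
    have e1 : (-1 : ℤ) ^ ((k + m + 1 - j) + (k - j) + 1) = (-1) ^ m := by
      rw [show (k + m + 1 - j) + (k - j) + 1 = m + 2 * (k - j + 1) by omega, pow_add, pow_mul]
      simp
    rw [e1, show k + m + 1 - j - 1 = (k - j - 1) + (m + 1) by omega, pow_add]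
    rcases Nat.even_or_odd m with h | h <;> simp [h.neg_one_pow, mul_assoc]
  have h2 : k.choose k • (-1 : ℤ) ^ ((k + m + 1 - k) + (k - k) + 1) •
      (booleanOpen k * ((va - vb) ^ (k + m + 1 - k - 1) * vb)) =
      (-1) ^ m * (booleanOpen k * ((va - vb) ^ m * vb)) := by
    rw [show k + m + 1 - k - 1 = m by omega,
      show (k + m + 1 - k) + (k - k) + 1 = m + 2 by omega, pow_add]
    rcases Nat.even_or_odd m with h | h <;> simp [h.neg_one_pow]
  rw [h1, h2, booleanOpen_of_pos hk, show k + m + 1 - k - 1 = m by omega,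
    show k + m + 1 - k = m + 1 by omega]
  have e : booleanIndex k * vb * (va - vb) ^ (m + 1) =
      booleanIndex k * vb * ((va - vb) ^ m * (va - vb)) := by rw [pow_succ]
  rw [e, pow_succ']
  rcases Nat.even_or_odd m with h | h <;> simp only [h.neg_one_pow] <;>
    generalize (va - vb) ^ m = u <;> noncomm_ring

/-! ### Boundary of the simplex and the induction on rank -/

/-- Rewrite `C(n+1,j) C(j,i) = C(n+1,i) C(n+1-i,j-i)`; what remains is the alternating sum of a row
of positive index `n+1-i`. -/
theorem sum_choose_mul_choose_mul_neg_one_pow {n i : ℕ} (hi : i ≤ n) :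
    ∑ j ∈ Finset.range (n + 2), ((n + 1).choose j * j.choose i * (-1) ^ j : ℤ) = 0 := by
  obtain ⟨N, rfl⟩ := Nat.exists_eq_add_of_le hi
  rw [show i + N + 2 = i + (N + 1 + 1) by ring, Finset.sum_range_add]
  have h1 : ∑ j ∈ Finset.range i, ((i + N + 1).choose j * j.choose i * (-1) ^ j : ℤ) = 0 :=
    Finset.sum_eq_zero fun j hj => by
      rw [Nat.choose_eq_zero_of_lt (Finset.mem_range.mp hj)]
      simp
  have h2 : ∀ t ∈ Finset.range (N + 1 + 1),
      ((i + N + 1).choose (i + t) * (i + t).choose i * (-1) ^ (i + t) : ℤ) =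
        (-1) ^ i * (i + N + 1).choose i * ((-1) ^ t * (N + 1).choose t) := fun t ht => by
    have := Nat.choose_mul (n := i + N + 1) (k := i + t) (s := i) (by omega)
    rw [show i + N + 1 - i = N + 1 by omega, show i + t - i = t by omega] at this
    rw [← Nat.cast_mul, this]
    push_cast
    ring
  rw [h1, zero_add, Finset.sum_congr rfl h2, ← Finset.mul_sum,
    Int.alternating_sum_range_choose_of_ne (Nat.succ_ne_zero N), mul_zero]

/-- The `n`-th semisuspension of the boundary of the `n`-simplex is the Boolean lattice. -/
theorem sum_choose_smul_faceTerm (n : ℕ) :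
    ∑ j ∈ Finset.range (n + 1), (n + 1).choose j • faceTerm n j = booleanIndex (n + 1) := by
  set X : ℕ → ABPoly := fun i => booleanOpen i * ((va - vb) ^ (n - i - 1) * vb) with hX
  -- The inner sum is extended to all `i ≤ n`, the terms `i > j` being zero, so that the two sums
  -- can be exchanged.
  have h1 : ∀ j ∈ Finset.range (n + 1), (n + 1).choose j • faceTerm n j =
      (n + 1).choose j • (booleanOpen j * (va - vb) ^ (n + 1 - j - 1)) +
      (((n + 1).choose j : ℤ) • X j +
        ∑ i ∈ Finset.range (n + 1),
          ((-1) ^ (n + 1) * ((n + 1).choose j * j.choose i * (-1) ^ j) : ℤ) • X i) := by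
    intro j hj
    have hj := Finset.mem_range.mp hj
    rw [faceTerm, smul_add, smul_add, show n + 1 - j - 1 = n - j by omega, add_assoc]
    congr 2
    · rw [show n + 1 = (j + 1) + (n - j) by omega, Finset.sum_range_add _ (j + 1)]
      have : ∑ x ∈ Finset.range (n - j), ((-1) ^ (j + 1 + (n - j)) *
          ((j + 1 + (n - j)).choose j * j.choose (j + 1 + x) * (-1) ^ j) : ℤ) •
          X (j + 1 + x) = 0 := by
        refine Finset.sum_eq_zero fun x _ => ?_
        rw [Nat.choose_eq_zero_of_lt (show j < j + 1 + x by omega)]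
        simp
      rw [this, add_zero, Finset.smul_sum]
      refine Finset.sum_congr rfl fun i hi => ?_
      have hi := Finset.mem_range.mp hi
      have e : (-1 : ℤ) ^ ((n - i) + (j - i) + 1) = (-1) ^ (j + 1 + (n - j)) * (-1) ^ j := by
        rw [← pow_add, show j + 1 + (n - j) + j = (n - i) + (j - i) + 1 + 2 * i by omega,
          pow_add _ _ (2 * i), pow_mul (-1 : ℤ) 2 i]
        simp
      rw [e, ← natCast_zsmul, ← natCast_zsmul, smul_smul, smul_smul]
      congr 1
      ring
  rw [Finset.sum_congr rfl h1, Finset.sum_add_distrib, Finset.sum_add_distrib, Finset.sum_comm,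
    ← Finset.sum_add_distrib, booleanIndex, add_eq_left]
  refine Finset.sum_eq_zero fun i hi => ?_
  have hi := Finset.mem_range.mp hi
  -- The vanishing sum includes `j = n + 1`, the missing full simplex; its term cancels the
  -- remaining `C(n+1,i)`. This reflects `ζ̄(G, *) = 0`, the links being spheres.
  have := sum_choose_mul_choose_mul_neg_one_pow (n := n) (i := i) (by omega)
  rw [Finset.sum_range_succ, Nat.choose_self] at this
  rw [← Finset.sum_smul, ← Finset.mul_sum, ← add_smul, eq_neg_of_add_eq_zero_left this]
  have e : (-1 : ℤ) ^ (n + 1) * (-1) ^ (n + 1) = 1 := by rw [← mul_pow]; simp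
  have : ((n + 1).choose i : ℤ) + (-1) ^ (n + 1) *
      -(((1 : ℕ) : ℤ) * ((n + 1).choose i) * (-1) ^ (n + 1)) = 0 := by
    linear_combination (-((n + 1).choose i : ℤ)) * e
  rw [this, zero_smul]

theorem faceTerm_mem_of_booleanIndex_mem {n k : ℕ} (h : k ≤ n)
    (hk : 0 < k → booleanIndex k ∈ cdPoly) : faceTerm n k ∈ cdPoly := by
  rcases Nat.eq_zero_or_pos k with rfl | hpos
  · rcases n with _ | m
    · rw [faceTerm_zero_zero]
      exact one_mem _
    · rw [faceTerm_zero]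
      exact pow_sub_mul_mem m
  · rcases h.eq_or_lt with rfl | hlt
    · rw [faceTerm_self hpos]
      exact zero_mem _
    · obtain ⟨m, rfl⟩ := Nat.exists_eq_add_of_lt hlt
      rw [faceTerm_of_lt hpos]
      exact mul_mem (hk hpos) (vb_mul_pow_mul_va_mem m)

/-- The rank `n + 1` index is a combination of `faceTerm n j` with `j ≤ n`, and these involve only
Boolean indices of smaller rank. -/
theorem booleanIndex_mem (k : ℕ) : 0 < k → booleanIndex k ∈ cdPoly := by
  induction k using Nat.strong_induction_on with
  | _ k ih =>
    intro hk
    obtain ⟨n, rfl⟩ := Nat.exists_eq_succ_of_ne_zero hk.ne'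
    rw [Nat.succ_eq_add_one, ← sum_choose_smul_faceTerm]
    refine sum_mem fun j hj => nsmul_mem ?_ _
    have hj := Finset.mem_range.mp hj
    exact faceTerm_mem_of_booleanIndex_mem (by omega) (ih j (by omega))

theorem faceTerm_mem {n k : ℕ} (h : k ≤ n) : faceTerm n k ∈ cdPoly :=
  faceTerm_mem_of_booleanIndex_mem h (booleanIndex_mem k)

/-! ### The `ab`-index of a semisuspension in terms of its faces -/

section

variable {V : Type*}

/-- All faces of a finite complex, as a finset. -/
noncomputable def faceFinset (Δ : PreAbstractSimplicialComplex V) [Finite Δ.faces] :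
    Finset (Finset V) :=
  (show (allFaces Δ).Finite from (Set.toFinite Δ.faces).insert ∅).toFinset

theorem mem_faceFinset {Δ : PreAbstractSimplicialComplex V} [Finite Δ.faces] {G : Finset V} :
    G ∈ faceFinset Δ ↔ G ∈ allFaces Δ :=
  Set.Finite.mem_toFinset _

theorem mem_allFaces_of_subset {Δ : PreAbstractSimplicialComplex V} {G H : Finset V}
    (hH : H ∈ allFaces Δ) (h : G ⊆ H) : G ∈ allFaces Δ := by
  rcases G.eq_empty_or_nonempty with rfl | hG
  · exact Set.mem_insert _ _
  · rcases hH with rfl | hH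
    · exact absurd (Finset.subset_empty.mp h) hG.ne_empty
    · exact Or.inr ((Δ.isRelLowerSet_faces hH).2 h hG)

/-- A face, as an element of the face poset of the semisuspension. -/
def faceElt {Δ : PreAbstractSimplicialComplex V} (F : FacePoset Δ) : SemiPoset Δ :=
  ((F : WithTop (FacePoset Δ)) : WithTop (WithTop (FacePoset Δ)))

/-- The element `*` of the semisuspension. -/
def starElt (Δ : PreAbstractSimplicialComplex V) : SemiPoset Δ :=
  ((⊤ : WithTop (FacePoset Δ)) : WithTop (WithTop (FacePoset Δ)))

section

variable {Δ : PreAbstractSimplicialComplex V}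

theorem faceElt_lt_faceElt {F G : FacePoset Δ} : faceElt F < faceElt G ↔ F.1 ⊂ G.1 :=
  WithTop.coe_lt_coe.trans WithTop.coe_lt_coe

theorem faceElt_injective {F G : FacePoset Δ} (h : faceElt F = faceElt G) : F = G :=
  WithTop.coe_injective (WithTop.coe_injective h)

theorem faceElt_lt_starElt (F : FacePoset Δ) : faceElt F < starElt Δ :=
  WithTop.coe_lt_coe.mpr (WithTop.coe_lt_top _)

theorem lt_faceElt_iff {x : SemiPoset Δ} {F : FacePoset Δ} :
    x < faceElt F ↔ ∃ G : FacePoset Δ, G.1 ⊂ F.1 ∧ x = faceElt G := by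
  constructor
  · intro h
    rcases x with _ | _ | G
    · exact absurd h not_top_lt
    · exact absurd (h.trans (faceElt_lt_starElt F)) (lt_irrefl _)
    · exact ⟨G, faceElt_lt_faceElt.mp h, rfl⟩
  · rintro ⟨G, h, rfl⟩
    exact faceElt_lt_faceElt.mpr h

theorem lt_starElt_iff {x : SemiPoset Δ} :
    x < starElt Δ ↔ ∃ G : FacePoset Δ, x = faceElt G := by
  constructor
  · intro h
    rcases x with _ | _ | G
    · exact absurd h not_top_lt
    · exact absurd h (lt_irrefl _)
    · exact ⟨G, rfl⟩
  · rintro ⟨G, rfl⟩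
    exact faceElt_lt_starElt G

theorem lt_top_iff_eq_starElt_or_lt {x : SemiPoset Δ} :
    x < ⊤ ↔ x = starElt Δ ∨ x < starElt Δ := by
  constructor
  · intro h
    rcases x with _ | _ | G
    · exact absurd h (lt_irrefl _)
    · exact Or.inl rfl
    · exact Or.inr (faceElt_lt_starElt G)
  · rintro (rfl | h)
    · exact WithTop.coe_lt_top _
    · exact h.trans_le le_top

theorem sum_eq_sum_faces {M : Type*} [AddCommMonoid M] {s : Finset (SemiPoset Δ)}
    {t : Finset (Finset V)} (ht : ∀ G ∈ t, G ∈ allFaces Δ)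
    (hs : ∀ x, x ∈ s ↔ ∃ G : FacePoset Δ, G.1 ∈ t ∧ x = faceElt G)
    {g : SemiPoset Δ → M} {g' : Finset V → M}
    (hg : ∀ G : FacePoset Δ, G.1 ∈ t → g (faceElt G) = g' G.1) :
    ∑ x ∈ s, g x = ∑ G ∈ t, g' G := by
  symm
  refine Finset.sum_bij (fun G hG => faceElt ⟨G, ht G hG⟩) ?_ ?_ ?_ ?_
  · exact fun G hG => (hs _).mpr ⟨⟨G, ht G hG⟩, hG, rfl⟩
  · exact fun G hG H hH h => congrArg Subtype.val (faceElt_injective h)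
  · intro x hx
    obtain ⟨G, hG, rfl⟩ := (hs x).mp hx
    exact ⟨G.1, hG, rfl⟩
  · exact fun G hG => (hg ⟨G, ht G hG⟩ hG).symm

end

variable [DecidableEq V]

theorem sum_ssubsets_apply_card {M : Type*} [AddCommGroup M] (f : ℕ → M) (s : Finset V) :
    ∑ t ∈ s.ssubsets, f t.card = ∑ j ∈ Finset.range s.card, s.card.choose j • f j := by
  rw [Finset.ssubsets, Finset.sum_erase_eq_sub (Finset.mem_powerset_self s),
    Finset.sum_powerset_apply_card, Finset.sum_range_succ]
  simp

theorem mem_allFaces_link {Δ : PreAbstractSimplicialComplex V} {F G : Finset V}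
    (hF : F ∈ allFaces Δ) : G ∈ allFaces (link Δ F) ↔ Disjoint F G ∧ F ∪ G ∈ allFaces Δ := by
  constructor
  · rintro (rfl | ⟨-, hd, hu⟩)
    · simpa using hF
    · exact ⟨hd, Or.inr hu⟩
  · rintro ⟨hd, hu⟩
    rcases G.eq_empty_or_nonempty with rfl | hG
    · exact Set.mem_insert _ _
    · rcases hu with hu | hu
      · exact absurd (Finset.union_eq_empty.mp hu).2 hG.ne_empty
      · exact Or.inr ⟨hG, hd, hu⟩

/-- Faces of the link correspond to faces `H ⊇ F` through `H ↦ H \ F`. -/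
theorem reducedEulerChar_link (Δ : PreAbstractSimplicialComplex V) [Finite Δ.faces]
    {F : Finset V} (hF : F ∈ allFaces Δ) :
    reducedEulerChar (link Δ F) =
      ∑ H ∈ faceFinset Δ with F ⊆ H, (-1 : ℤ) ^ (H.card - F.card + 1) := by
  have h : allFaces (link Δ F) =
      (((faceFinset Δ).filter (F ⊆ ·)).image (· \ F) : Finset (Finset V)) := by
    ext G
    rw [mem_allFaces_link hF]
    simp only [Finset.coe_image, Finset.coe_filter, Set.mem_image, Set.mem_ofPred_eq,
      mem_faceFinset]
    constructor
    · rintro ⟨hd, hu⟩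
      exact ⟨F ∪ G, ⟨hu, Finset.subset_union_left⟩, Finset.union_sdiff_cancel_left hd⟩
    · rintro ⟨H, ⟨hH, hFH⟩, rfl⟩
      exact ⟨Finset.disjoint_sdiff, by rwa [Finset.union_sdiff_of_subset hFH]⟩
  rw [reducedEulerChar, h, finsum_mem_coe_finset, Finset.sum_image]
  · refine Finset.sum_congr rfl fun H hH => ?_
    rw [Finset.card_sdiff_of_subset (Finset.mem_filter.mp hH).2]
  · intro H hH H' hH' he
    have h1 := (Finset.mem_filter.mp hH).2
    have h2 := (Finset.mem_filter.mp hH').2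
    rw [← Finset.union_sdiff_of_subset h1, ← Finset.union_sdiff_of_subset h2]
    exact congrArg _ he

variable (Δ : PreAbstractSimplicialComplex V) [Finite Δ.faces] (n : ℕ) (hn : DimLT Δ n)

theorem semi_zeta_face {F : FacePoset Δ} {y : SemiPoset Δ} (hy : y ≠ starElt Δ)
    (h : faceElt F ≤ y) : (semi Δ n hn).zeta (faceElt F) y = 1 := by
  refine (semiZeta_apply Δ n h).trans ?_
  rcases y with _ | _ | y
  · rfl
  · exact absurd rfl hy
  · rfl

/-- Below a face lies the full Boolean lattice of its subsets, with `ζ̄ = 1`, so both sides satisfy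
the same recursion. -/
theorem openIndex_faceElt (k : ℕ) : ∀ F : FacePoset Δ, F.1.card = k →
    (semi Δ n hn).openIndex (faceElt F) = booleanOpen k := by
  classical
  induction k using Nat.strong_induction_on with
  | _ k ih =>
    intro F hF
    have := Fintype.ofFinite (SemiPoset Δ)
    rcases Nat.eq_zero_or_pos k with rfl | hk
    · have : faceElt F = ⊥ := by
        have : F = ⊥ := Subtype.ext (Finset.card_eq_zero.mp hF)
        rw [this]
        rfl
      rw [this, QuasiGradedPoset.openIndex_bot, booleanOpen_zero]
    · have hne : faceElt F ≠ ⊥ := fun h => by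
        have : F = ⊥ := faceElt_injective h
        rw [this] at hF
        exact hk.ne hF
      rw [QuasiGradedPoset.openIndex_of_ne_bot _ hne]
      refine (sum_eq_sum_faces (t := F.1.ssubsets)
        (g' := fun G => booleanOpen G.card * ((va - vb) ^ (k - G.card - 1) * vb))
        ?_ ?_ ?_).trans ?_
      · exact fun G hG => mem_allFaces_of_subset F.2 (Finset.mem_ssubsets.mp hG).1
      · intro x
        simp only [Finset.mem_filter, Finset.mem_univ, true_and, Finset.mem_ssubsets]
        exact lt_faceElt_iff
      · intro G hG
        have hG := Finset.mem_ssubsets.mp hG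
        rw [semi_zeta_face Δ n hn (faceElt_lt_starElt F).ne (faceElt_lt_faceElt.mpr hG).le,
          one_smul, ih G.1.card (hF ▸ Finset.card_lt_card hG) G rfl]
        change _ * ((va - vb) ^ (F.1.card - G.1.card - 1) * vb) = _
        rw [hF]
      · rw [sum_ssubsets_apply_card
            (fun j => booleanOpen j * ((va - vb) ^ (k - j - 1) * vb)), hF,
          booleanOpen_of_pos hk, booleanIndex, Finset.sum_mul]
        simp only [smul_mul_assoc, mul_assoc]

/-- The truncated exponent at `|G| = n` is harmless: the coefficient `ζ̄(G, *)` vanishes there. -/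
theorem openIndex_starElt :
    (semi Δ n hn).openIndex (starElt Δ) = ∑ G ∈ faceFinset Δ,
      (1 + (-1) ^ (n - G.card) * reducedEulerChar (link Δ G)) •
        (booleanOpen G.card * ((va - vb) ^ (n - G.card - 1) * vb)) := by
  classical
  have := Fintype.ofFinite (SemiPoset Δ)
  have hne : starElt Δ ≠ ⊥ := (faceElt_lt_starElt (⊥ : FacePoset Δ)).ne'
  rw [QuasiGradedPoset.openIndex_of_ne_bot _ hne]
  refine sum_eq_sum_faces (fun G hG => mem_faceFinset.mp hG) ?_ ?_
  · intro x
    simp only [Finset.mem_filter, Finset.mem_univ, true_and]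
    rw [lt_starElt_iff]
    exact exists_congr fun G => by simp [mem_faceFinset, G.2]
  · intro G hG
    rw [openIndex_faceElt Δ n hn _ G rfl]
    exact congrArg (· • _) (semiZeta_apply Δ n (faceElt_lt_starElt G).le)

theorem abIndex_semi :
    (semi Δ n hn).abIndex = ∑ G ∈ faceFinset Δ,
      ((1 + (-1) ^ (n - G.card) * reducedEulerChar (link Δ G)) •
        (booleanOpen G.card * ((va - vb) ^ (n - G.card - 1) * vb)) +
      booleanOpen G.card * (va - vb) ^ (n - G.card)) := by
  classical
  have := Fintype.ofFinite (SemiPoset Δ)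
  have hne : (⊤ : SemiPoset Δ) ≠ ⊥ := (lt_top_iff_eq_starElt_or_lt.mpr (Or.inr
    (faceElt_lt_starElt (⊥ : FacePoset Δ)))).ne'
  have hs : (Finset.univ.filter fun x : SemiPoset Δ => x < ⊤) =
      insert (starElt Δ) (Finset.univ.filter fun x : SemiPoset Δ => x < starElt Δ) := by
    ext x
    simp only [Finset.mem_filter, Finset.mem_univ, true_and, Finset.mem_insert]
    exact lt_top_iff_eq_starElt_or_lt
  rw [QuasiGradedPoset.abIndex_eq_sum_openIndex _ hne, hs, Finset.sum_insert (by simp),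
    openIndex_starElt, Finset.sum_add_distrib]
  congr 1
  · have h1 : (semi Δ n hn).zeta (starElt Δ) ⊤ = 1 := semiZeta_apply Δ n le_top
    have h2 : (semi Δ n hn).rank ⊤ - (semi Δ n hn).rank (starElt Δ) - 1 = 0 := by
      change n + 1 - n - 1 = 0
      omega
    rw [h1, h2, one_smul, pow_zero, mul_one]
  · refine sum_eq_sum_faces (fun G hG => mem_faceFinset.mp hG) ?_ ?_
    · intro x
      simp only [Finset.mem_filter, Finset.mem_univ, true_and]
      rw [lt_starElt_iff]
      exact exists_congr fun G => by simp [mem_faceFinset, G.2]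
    · intro G hG
      rw [semi_zeta_face Δ n hn (lt_top_iff_eq_starElt_or_lt.mpr (Or.inl rfl)).ne' le_top,
        one_smul, openIndex_faceElt Δ n hn _ G rfl]
      change _ * (va - vb) ^ (n + 1 - G.1.card - 1) = _
      rw [Nat.sub_right_comm, Nat.add_sub_cancel]

/-- The `ab`-index of the semisuspension is a linear function of the `f`-vector. -/
theorem abIndex_semi_eq_sum_faceTerm :
    (semi Δ n hn).abIndex = ∑ G ∈ faceFinset Δ, faceTerm n G.card := by
  -- Charge the Euler characteristics to the larger face: expand over `H ⊇ G`, exchange the sums,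
  -- and count the subsets `G` of `H` by size.
  have key : ∑ G ∈ faceFinset Δ, ((-1) ^ (n - G.card) * reducedEulerChar (link Δ G)) •
        (booleanOpen G.card * ((va - vb) ^ (n - G.card - 1) * vb)) =
      ∑ H ∈ faceFinset Δ, ∑ j ∈ Finset.range (H.card + 1),
        H.card.choose j • (-1 : ℤ) ^ ((n - j) + (H.card - j) + 1) •
          (booleanOpen j * ((va - vb) ^ (n - j - 1) * vb)) := by
    have h1 : ∀ G ∈ faceFinset Δ, ((-1) ^ (n - G.card) * reducedEulerChar (link Δ G)) •
        (booleanOpen G.card * ((va - vb) ^ (n - G.card - 1) * vb)) =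
        ∑ H ∈ faceFinset Δ with G ⊆ H, (-1 : ℤ) ^ ((n - G.card) + (H.card - G.card) + 1) •
          (booleanOpen G.card * ((va - vb) ^ (n - G.card - 1) * vb)) := fun G hG => by
      rw [reducedEulerChar_link Δ (mem_faceFinset.mp hG), Finset.mul_sum, Finset.sum_smul]
      refine Finset.sum_congr rfl fun H _ => ?_
      rw [← pow_add, add_assoc]
    have h2 : ∀ H ∈ faceFinset Δ, ∑ j ∈ Finset.range (H.card + 1),
        H.card.choose j • (-1 : ℤ) ^ ((n - j) + (H.card - j) + 1) •
          (booleanOpen j * ((va - vb) ^ (n - j - 1) * vb)) =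
        ∑ G ∈ H.powerset, (-1 : ℤ) ^ ((n - G.card) + (H.card - G.card) + 1) •
          (booleanOpen G.card * ((va - vb) ^ (n - G.card - 1) * vb)) := fun H _ =>
      (Finset.sum_powerset_apply_card (fun j => (-1 : ℤ) ^ ((n - j) + (H.card - j) + 1) •
          (booleanOpen j * ((va - vb) ^ (n - j - 1) * vb)))).symm
    rw [Finset.sum_congr rfl h1, Finset.sum_congr rfl h2]
    refine Finset.sum_comm' fun G H => ?_
    simp only [Finset.mem_filter, Finset.mem_powerset, mem_faceFinset]
    exact ⟨fun h => ⟨h.2.2, h.2.1⟩, fun h => ⟨mem_allFaces_of_subset h.2 h.1, h.2, h.1⟩⟩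
  rw [abIndex_semi]
  simp only [add_smul, one_smul, faceTerm]
  rw [Finset.sum_add_distrib, Finset.sum_add_distrib, key, Finset.sum_add_distrib,
    Finset.sum_add_distrib]
  abel

/-- The `ab`-index of a semisuspension is a `cd`-index. -/
theorem abIndex_semi_mem : (semi Δ n hn).abIndex ∈ cdPoly := by
  rw [abIndex_semi_eq_sum_faceTerm]
  exact sum_mem fun G hG => faceTerm_mem (hn G (mem_faceFinset.mp hG))

end

/-! ### Shelling orders and prior intersections -/

section

variable {V : Type*} {m : ℕ} {F : Fin m → Finset V}

theorem exists_maximal_priorIntersection {r : Fin m} {G : Finset V}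
    (hG : G ∈ priorIntersection F r) :
    ∃ M, G ⊆ M ∧ Maximal (· ∈ priorIntersection F r) M := by
  have hfin : (priorIntersection F r).Finite :=
    (Finset.finite_toSet (F r).powerset).subset fun H hH => by simpa using hH.2
  exact hfin.exists_le_maximal hG

variable {Δ : PreAbstractSimplicialComplex V}

theorem IsShellingOrder.pure_all (hF : IsShellingOrder Δ F) (r : Fin m) (G : Finset V)
    (hG : Maximal (· ∈ priorIntersection F r) G) : G.card + 1 = (F r).card := by
  -- For the first facet the prior intersection is empty, without even `∅`, so purity is vacuous and
  -- `r = 0` needs no separate treatment later.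
  rcases Nat.eq_zero_or_pos (r : ℕ) with h | h
  · obtain ⟨⟨j, hj, -⟩, -⟩ := hG.prop
    have : (j : ℕ) < r := hj
    omega
  · exact hF.pure r h G hG

theorem IsShellingOrder.mem_allFaces (hF : IsShellingOrder Δ F) (r : Fin m) :
    F r ∈ allFaces Δ := by
  have : F r ∈ {G | IsFacet Δ G} := hF.range_eq ▸ Set.mem_range_self r
  exact this.prop

theorem IsShellingOrder.exists_subset [Finite Δ.faces] (hF : IsShellingOrder Δ F) {G : Finset V}
    (hG : G ∈ allFaces Δ) : ∃ r, G ⊆ F r := by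
  have hfin : (allFaces Δ).Finite := (Set.toFinite Δ.faces).insert ∅
  obtain ⟨M, hGM, hM⟩ := hfin.exists_le_maximal hG
  have : M ∈ Set.range F := hF.range_eq ▸ hM
  obtain ⟨r, rfl⟩ := this
  exact ⟨r, hGM⟩

end

/-! ### Sums of face terms over intervals -/

section

variable {V : Type*} [DecidableEq V]

/-- The contribution to the `ab`-index of a facet of shelling type `(k, i)`. -/
noncomputable def typeTerm (n k i : ℕ) : ABPoly :=
  ∑ j ∈ Finset.range (k - i + 1), (k - i).choose j • faceTerm n (j + i)

theorem sum_Icc_faceTerm (n : ℕ) {R F : Finset V} (h : R ⊆ F) :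
    ∑ G ∈ Finset.Icc R F, faceTerm n G.card = typeTerm n F.card R.card := by
  rw [typeTerm, ← Finset.card_sdiff_of_subset h,
    ← Finset.sum_powerset_apply_card (fun j => faceTerm n (j + R.card)),
    Finset.Icc_eq_image_powerset h, Finset.sum_image]
  · refine Finset.sum_congr rfl fun S hS => ?_
    rw [Finset.card_union_of_disjoint, add_comm]
    exact Finset.disjoint_sdiff.mono_right (Finset.mem_powerset.mp hS)
  · intro S hS T hT hST
    have hS' := Finset.disjoint_sdiff.mono_right (Finset.mem_powerset.mp hS)
    have hT' := Finset.disjoint_sdiff.mono_right (Finset.mem_powerset.mp hT)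
    rw [← Finset.union_sdiff_cancel_left hS', ← Finset.union_sdiff_cancel_left hT']
    exact congrArg (· \ R) hST

/-! ### Shelling components -/

theorem mem_faceFinset_simplexFacets {k i : ℕ} {G : Finset (Fin (k + 1))} :
    G ∈ faceFinset (simplexFacets k i) ↔ ∃ j : Fin (k + 1), (j : ℕ) ≤ i ∧ j ∉ G := by
  rw [mem_faceFinset]
  constructor
  · rintro (rfl | ⟨-, h⟩)
    · exact ⟨0, Nat.zero_le _, Finset.notMem_empty _⟩
    · exact h
  · intro h
    rcases G.eq_empty_or_nonempty with rfl | hG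
    · exact Set.mem_insert _ _
    · exact Or.inr ⟨hG, h⟩

/-- Adding the facet opposite vertex `i` creates exactly the faces that avoid `i` and contain `0, …,
i-1`: an interval whose ends have sizes `i` and `k`. -/
theorem shellingComponent_eq_typeTerm {n k : ℕ} (hk : k ≤ n) {i : ℕ} (hi : i ≤ k) :
    shellingComponent n k hk i = typeTerm n k i := by
  rcases i with _ | i
  · have h : faceFinset (simplexFacets k 0) = Finset.Icc ∅ (Finset.univ.erase 0) := by
      ext G
      rw [mem_faceFinset_simplexFacets, Finset.mem_Icc]
      constructor
      · rintro ⟨j, hj, hjG⟩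
        have : j = 0 := Fin.ext (by simpa using hj)
        subst this
        exact ⟨Finset.empty_subset _, Finset.subset_erase.mpr ⟨Finset.subset_univ _, hjG⟩⟩
      · exact fun h => ⟨0, le_rfl, (Finset.subset_erase.mp h.2).2⟩
    rw [shellingComponent, psiP, abIndex_semi_eq_sum_faceTerm, h,
      sum_Icc_faceTerm n (Finset.empty_subset _), Finset.card_erase_of_mem (Finset.mem_univ _)]
    simp
  · have hv : i + 1 < k + 1 := by omega
    set v : Fin (k + 1) := ⟨i + 1, hv⟩ with hvdef
    have hsub : Finset.Iio v ⊆ Finset.univ.erase v := fun j hj =>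
      Finset.mem_erase.mpr ⟨(Finset.mem_Iio.mp hj).ne, Finset.mem_univ _⟩
    have h : faceFinset (simplexFacets k (i + 1)) =
        (faceFinset (simplexFacets k i)).disjUnion
          (Finset.Icc (Finset.Iio v) (Finset.univ.erase v)) (by
            refine Finset.disjoint_left.mpr fun G hG hG' => ?_
            obtain ⟨j, hj, hjG⟩ := mem_faceFinset_simplexFacets.mp hG
            exact hjG ((Finset.mem_Icc.mp hG').1
              (Finset.mem_Iio.mpr (Fin.lt_def.mpr (Nat.lt_succ_of_le hj))))) := by
      ext G
      rw [Finset.mem_disjUnion, mem_faceFinset_simplexFacets, mem_faceFinset_simplexFacets,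
        Finset.mem_Icc]
      constructor
      · rintro ⟨j, hj, hjG⟩
        by_cases h : ∃ j : Fin (k + 1), (j : ℕ) ≤ i ∧ j ∉ G
        · exact Or.inl h
        · push Not at h
          have : j = v := by
            by_contra hne
            have : (j : ℕ) ≠ i + 1 := fun h => hne (Fin.ext h)
            exact hjG (h j (by omega))
          subst this
          exact Or.inr ⟨fun l hl =>
            h l (Nat.le_of_lt_succ (Fin.lt_def.mp (Finset.mem_Iio.mp hl))),
            Finset.subset_erase.mpr ⟨Finset.subset_univ _, hjG⟩⟩
      · rintro (⟨j, hj, hjG⟩ | h)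
        · exact ⟨j, by omega, hjG⟩
        · exact ⟨v, le_rfl, (Finset.subset_erase.mp h.2).2⟩
    rw [shellingComponent, psiP, psiP, abIndex_semi_eq_sum_faceTerm, abIndex_semi_eq_sum_faceTerm,
      h, Finset.sum_disjUnion, add_sub_cancel_left, sum_Icc_faceTerm n hsub,
      Finset.card_erase_of_mem (Finset.mem_univ _), Fin.card_Iio]
    simp [hvdef]

/-! ### Shellings -/

section

variable {m : ℕ} {F : Fin m → Finset V}

/-- The vertices `v` of `F r` for which `F r \ {v}` lies in an earlier facet. -/
noncomputable def restriction (F : Fin m → Finset V) (r : Fin m) : Finset V :=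
  open Classical in (F r).filter fun v => (F r).erase v ∈ priorIntersection F r

theorem mem_restriction {r : Fin m} {v : V} :
    v ∈ restriction F r ↔ v ∈ F r ∧ (F r).erase v ∈ priorIntersection F r := by
  classical
  simp [restriction]

theorem restriction_subset (r : Fin m) : restriction F r ⊆ F r :=
  fun _ h => (mem_restriction.mp h).1

theorem exists_erase_of_maximal {r : Fin m}
    (hp : ∀ G, Maximal (· ∈ priorIntersection F r) G → G.card + 1 = (F r).card)
    {G : Finset V} (hG : Maximal (· ∈ priorIntersection F r) G) :
    ∃ v ∈ restriction F r, G = (F r).erase v := by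
  have hsub : G ⊆ F r := hG.prop.2
  have hc := hp G hG
  have h1 : (F r \ G).card = 1 := by
    rw [Finset.card_sdiff_of_subset hsub]
    omega
  obtain ⟨v, hv⟩ := Finset.card_eq_one.mp h1
  have hG' : G = (F r).erase v := by
    rw [← Finset.sdiff_singleton_eq_erase, ← hv, Finset.sdiff_sdiff_eq_self hsub]
  have hvF : v ∈ F r := (Finset.mem_sdiff.mp (hv ▸ Finset.mem_singleton_self v)).1
  exact ⟨v, mem_restriction.mpr ⟨hvF, hG' ▸ hG.prop⟩, hG'⟩

/-- The restriction is the unique minimal new face. By purity an old face lies in some old `F r \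
{v}`, so it misses a vertex `v` of the restriction; conversely, missing such a `v` puts it inside `F
r \ {v}`. -/
theorem mem_priorIntersection_iff {r : Fin m}
    (hp : ∀ G, Maximal (· ∈ priorIntersection F r) G → G.card + 1 = (F r).card)
    {G : Finset V} (hG : G ⊆ F r) :
    G ∈ priorIntersection F r ↔ ¬ restriction F r ⊆ G := by
  constructor
  · intro h hR
    obtain ⟨M, hGM, hM⟩ := exists_maximal_priorIntersection h
    obtain ⟨v, hv, rfl⟩ := exists_erase_of_maximal hp hM
    exact Finset.notMem_erase v _ (hGM (hR hv))
  · intro h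
    obtain ⟨v, hv, hvG⟩ := Finset.not_subset.mp h
    obtain ⟨⟨j, hj, hjs⟩, -⟩ := (mem_restriction.mp hv).2
    exact ⟨⟨j, hj, (Finset.subset_erase.mpr ⟨hG, hvG⟩).trans hjs⟩, hG⟩

/-- The facets of the prior intersection are the sets `F r \ {v}` for `v` in the restriction, so the
shelling type can be read off as `(|F r|, |R|)`. -/
theorem ncard_maximal_priorIntersection {r : Fin m}
    (hp : ∀ G, Maximal (· ∈ priorIntersection F r) G → G.card + 1 = (F r).card) :
    {G | Maximal (· ∈ priorIntersection F r) G}.ncard = (restriction F r).card := by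
  have h : {G | Maximal (· ∈ priorIntersection F r) G} =
      ((restriction F r).image fun v => (F r).erase v : Finset (Finset V)) := by
    ext G
    simp only [Set.mem_ofPred_eq, Finset.coe_image, Set.mem_image, Finset.mem_coe]
    constructor
    · intro hG
      obtain ⟨v, hv, rfl⟩ := exists_erase_of_maximal hp hG
      exact ⟨v, hv, rfl⟩
    · rintro ⟨v, hv, rfl⟩
      obtain ⟨M, hvM, hM⟩ := exists_maximal_priorIntersection (mem_restriction.mp hv).2
      have hc := hp M hM
      have hc' := Finset.card_erase_add_one (mem_restriction.mp hv).1
      rwa [Finset.eq_of_subset_of_card_le hvM (by omega)]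
  rw [h, Set.ncard_coe_finset, Finset.card_image_of_injOn]
  intro v hv w hw hvw
  by_contra hne
  have : v ∈ (F r).erase w := Finset.mem_erase.mpr ⟨hne, (mem_restriction.mp hv).1⟩
  exact Finset.notMem_erase v (F r) ((show (F r).erase v = (F r).erase w from hvw) ▸ this)

variable {Δ : PreAbstractSimplicialComplex V}

/-- Every face lies in exactly one of the intervals from the restriction of a facet to it. -/
theorem IsShellingOrder.sum_faceFinset [Finite Δ.faces] (hF : IsShellingOrder Δ F)
    {M : Type*} [AddCommMonoid M]
    (g : Finset V → M) :
    ∑ G ∈ faceFinset Δ, g G = ∑ r, ∑ G ∈ Finset.Icc (restriction F r) (F r), g G := by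
  -- `G` lies in the interval of `r` exactly when `F r` is the first facet containing `G`; this
  -- gives both covering and disjointness.
  have hmem : ∀ r G, G ∈ Finset.Icc (restriction F r) (F r) ↔
      G ⊆ F r ∧ ∀ j < r, ¬ G ⊆ F j := by
    intro r G
    rw [Finset.mem_Icc, and_comm]
    refine and_congr_right fun h => ?_
    have := mem_priorIntersection_iff (hF.pure_all r) h
    rw [← not_iff_not, ← this]
    simp only [priorIntersection, Set.mem_ofPred_eq]
    push Not
    exact ⟨fun h => h.1, fun h' => ⟨h', h⟩⟩
  have hU : faceFinset Δ =
      Finset.univ.biUnion fun r => Finset.Icc (restriction F r) (F r) := by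
    ext G
    simp only [Finset.mem_biUnion, Finset.mem_univ, true_and, hmem, mem_faceFinset]
    constructor
    · intro hG
      have hex := hF.exists_subset hG
      classical
      obtain ⟨r, hr, hmin⟩ := WellFounded.has_min (wellFounded_lt (α := Fin m))
        {r | G ⊆ F r} hex
      exact ⟨r, hr, fun j hj hGj => hmin j hGj hj⟩
    · rintro ⟨r, hr, -⟩
      exact mem_allFaces_of_subset (hF.mem_allFaces r) hr
  rw [hU, Finset.sum_biUnion]
  intro r _ s _ hrs
  refine Finset.disjoint_left.mpr fun G hr hs => ?_
  have hr := (hmem r G).mp hr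
  have hs := (hmem s G).mp hs
  rcases lt_or_gt_of_ne hrs with h | h
  · exact hs.2 r h hr.1
  · exact hr.2 s h hs.1

theorem IsShellingOrder.abIndex_eq_sum_typeTerm [Finite Δ.faces] (hF : IsShellingOrder Δ F)
    (n : ℕ) (hn : DimLT Δ n) :
    (semi Δ n hn).abIndex = ∑ r, typeTerm n (F r).card (restriction F r).card := by
  rw [abIndex_semi_eq_sum_faceTerm, hF.sum_faceFinset]
  exact Finset.sum_congr rfl fun r _ => sum_Icc_faceTerm n (restriction_subset r)

/-- Group the facets by type. The ranges `k ≤ n` and `i ≤ k` miss none, by the dimension bound and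
because the restriction is a subset of its facet. -/
theorem IsShellingOrder.sum_eq_sum_hTriangle (hF : IsShellingOrder Δ F) {n : ℕ}
    (hn : DimLT Δ n) {M : Type*} [AddCommMonoid M] (g : ℕ → ℕ → M) :
    ∑ r, g (F r).card (restriction F r).card =
      ∑ k : Fin (n + 1), ∑ i ∈ Finset.range ((k : ℕ) + 1), hTriangle F k i • g k i := by
  rw [Fin.sum_univ_eq_sum_range (fun k => ∑ i ∈ Finset.range (k + 1), hTriangle F k i • g k i),
    Finset.sum_sigma', ← Finset.sum_fiberwise_of_maps_to
      (g := fun r => (⟨(F r).card, (restriction F r).card⟩ : Σ _ : ℕ, ℕ))]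
  · refine Finset.sum_congr rfl fun p _ => ?_
    have h : hTriangle F p.1 p.2 = (Finset.univ.filter fun r : Fin m =>
        (⟨(F r).card, (restriction F r).card⟩ : Σ _ : ℕ, ℕ) = p).card := by
      unfold hTriangle
      congr 1
      ext r
      rw [Finset.mem_filter, Finset.mem_filter, ncard_maximal_priorIntersection (hF.pure_all r)]
      rcases p with ⟨k, i⟩
      simp
    rw [h, ← Finset.sum_const]
    refine Finset.sum_congr rfl fun r hr => ?_
    rw [← (Finset.mem_filter.mp hr).2]
  · intro r _
    simp only [Finset.mem_sigma, Finset.mem_range]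
    exact ⟨Nat.lt_succ_of_le (hn _ (hF.mem_allFaces r)),
      Nat.lt_succ_of_le (Finset.card_le_card (restriction_subset r))⟩

end

end

end Semisusp

theorem mainTheorem12 {V : Type*} [DecidableEq V] (Δ : PreAbstractSimplicialComplex V)
    [Finite Δ.faces] (n : ℕ) (hn : Semisusp.DimLT Δ n)
    {m : ℕ} (F : Fin m → Finset V) (hF : Semisusp.IsShellingOrder Δ F) :
    (Semisusp.semi Δ n hn).abIndex ∈ Semisusp.cdPoly ∧
    (Semisusp.semi Δ n hn).abIndex =
      ∑ k : Fin (n + 1), ∑ i ∈ Finset.range ((k : ℕ) + 1),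
        Semisusp.hTriangle F k i •
          Semisusp.shellingComponent n k (Nat.le_of_lt_succ k.isLt) i := by
  refine ⟨Semisusp.abIndex_semi_mem Δ n hn, ?_⟩
  rw [hF.abIndex_eq_sum_typeTerm, hF.sum_eq_sum_hTriangle hn (Semisusp.typeTerm n)]
  refine Finset.sum_congr rfl fun k _ => Finset.sum_congr rfl fun i hi => ?_
  rw [Semisusp.shellingComponent_eq_typeTerm _ (Nat.le_of_lt_succ (Finset.mem_range.mp hi))]
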